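/- Let $\mathbb T$ be the unit circle, identified with $\mathbb R/\mathbb Z$ via $\theta\mapsto e^{2\pi i\theta}$ and equipped with the distance of $\mathbb R/\mathbb Z$; let $m$ be Lebesgue measure on $\mathbb T$ with $m(\mathbb T)=1$. For a finite positive measure $\rho$ on $\mathbb T$ and $n\ge 0$ put $$e_n(\rho)=\min_{q_0,\dots,q_{n-1}\in\mathbb C}\Bigl(\int_{\mathbb T}\bigl|q_0+q_1t+\dots+q_{n-1}t^{n-1}+t^n\bigr|^2\,d\rho(t)\Bigr)^{1/2}.$$ For $K\subset\mathbb T$ let $d_K(t)=\operatorname{dist}(t,K)$. Let $\gamma\in[0,1)$ and $a,b>0$. Then there are constants $c,C>0$, depending only on $\gamma,a,b$, with the following property. Let $K\subset\mathbb T$ be a compact set that is $\gamma$-regular with constants $a,b$, i.e. $$a\,s^{1-\gamma}\le m\{t\in\mathbb T: d_K(t)<s\}\le b\,s^{1-\gamma}\qquad\text{for all } 0<s\le\tfrac12,$$ and let $d\rho=\exp\bigl(-d_K^{\gamma-1}\bigr)\,dm$ (the density being $0$ on $K$). Then for all integers $n\ge2$ $$c\,\log n\le|\log e_n(\rho)|\le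 C\,\log n .$$ -/

import Mathlib

/-- The circle `𝕋`, identified with `ℝ/ℤ`, with its distance `|x - y|` modulo `1`; the point `t`
corresponds to the complex number `exp (2 π i t)`, which is `AddCircle.toCircle t`, and
`AddCircle.haarAddCircle` is Lebesgue measure `m` with `m (𝕋) = 1`. -/
abbrev SzegoCircle : Type := UnitAddCircle

/-- `e_n(ρ)`: the infimum over `q_0, …, q_{n-1} ∈ ℂ` of the `L²(ρ)`-norm of
`q_0 + q_1 t + ⋯ + q_{n-1} t^{n-1} + t^n` on the unit circle. -/
noncomputable def szegoMin (ρ : MeasureTheory.Measure SzegoCircle) (n : ℕ) : ℝ :=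
  ⨅ q : Fin n → ℂ,
    Real.sqrt (∫ t : SzegoCircle,
      ‖(∑ j : Fin n, q j * (AddCircle.toCircle t : ℂ) ^ (j : ℕ))
        + (AddCircle.toCircle t : ℂ) ^ n‖ ^ 2 ∂ρ)

/-- `ψ_K(s)`: the normalized length of the open `s`-neighbourhood `{t | dist (t, K) < s}`. -/
noncomputable def nbhdLength (K : Set SzegoCircle) (s : ℝ) : ℝ :=
  AddCircle.haarAddCircle.real (Metric.thickening s K)

/-- `K` is `γ`-regular with constants `a`, `b`: `a s^{1-γ} ≤ ψ_K(s) ≤ b s^{1-γ}` for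
`0 < s ≤ 1/2` (distances on `ℝ/ℤ` do not exceed `1/2`). -/
def IsGammaRegularWith (γ a b : ℝ) (K : Set SzegoCircle) : Prop :=
  ∀ s : ℝ, 0 < s → s ≤ 1 / 2 →
    a * s ^ (1 - γ) ≤ nbhdLength K s ∧ nbhdLength K s ≤ b * s ^ (1 - γ)

/-- The measure `exp (-d_K^{γ-1}) dm`, where `d_K` is the distance to `K`. For `γ < 1` and closed
`K` the exponent is `-∞` exactly on `K`, so the density is `0` there. -/
noncomputable def deepZeroMeasure (γ : ℝ) (K : Set SzegoCircle) :
    MeasureTheory.Measure SzegoCircle :=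
  AddCircle.haarAddCircle.withDensity
    (Kᶜ.indicator fun t => ENNReal.ofReal (Real.exp (-(Metric.infDist t K ^ (γ - 1)))))

/-!
For a continuous weight `exp (-v)` on the circle, `e_n` is at least `exp (-(∫ v) / 2)`: apply
Jensen's inequality to `exp` and to `2 log |P| - v`, where `∫ log |P| ≥ 0` because `P` is monic.
The weight `exp (-d_K ^ (-κ))`, `κ = 1 - γ`, agrees off the `s`-neighbourhood `E` of `K` with the
one obtained by truncating the distance at `s`. A polynomial of degree `n` satisfies
`|P| ^ 2 ≤ (n + 1) ∫ |P| ^ 2`, so `E` carries at most half of the norm of `P` when `m E ≲ 1 / n`,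
which by regularity holds for `s ^ κ ≈ 1 / n`.

In the other direction, `exp (-(∫ v) / 2)` would be attained by the outer function with modulus
`exp (v / 2)`. Replace `v / 2` by a Fejér mean, which is the real part of an analytic polynomial
`H`, and `exp H` by a Taylor polynomial in `H`; reversing its coefficients gives a monic polynomial.
For `v` truncated at `s` all errors are bounded as soon as the degree is a fixed power of `1 / s`.

Finally, `∫ max (d_K, s) ^ (-κ)` is comparable to `log (1 / s)` by the layer cake formula, since the
superlevel sets are neighbourhoods of `K`.
-/

open MeasureTheory Polynomial Set
open AddCircle (haarAddCircle)

section LayerCake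

variable {X : Type*} [MeasurableSpace X] {μ : Measure X} {f : X → ℝ} {a b c Y : ℝ}

theorem antitone_measureReal_lt [IsFiniteMeasure μ] (f : X → ℝ) :
    Antitone fun y : ℝ => μ.real {x | y < f x} :=
  fun _ _ hle => measureReal_mono fun _ hx => hle.trans_lt hx

theorem integral_eq_intervalIntegral_measureReal_lt (hf : Integrable f μ) (hf0 : ∀ x, 0 ≤ f x)
    (hY : 0 ≤ Y) (hfY : ∀ x, f x ≤ Y) :
    ∫ x, f x ∂μ = ∫ y in 0..Y, μ.real {x | y < f x} := by
  rw [hf.integral_eq_integral_meas_lt (.of_forall hf0), intervalIntegral.integral_of_le hY]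
  refine setIntegral_eq_of_subset_of_forall_sdiff_eq_zero measurableSet_Ioi
    Ioc_subset_Ioi_self fun y hy => ?_
  have hYy : Y < y := not_le.1 fun hle => hy.2 ⟨hy.1, hle⟩
  have hempty : {x | y < f x} = ∅ :=
    eq_empty_of_forall_notMem fun x hx => (hYy.trans hx).not_ge (hfY x)
  rw [hempty, measureReal_empty]

theorem intervalIntegrable_mul_inv (a : ℝ) (hc : 0 < c) (hY : 0 < Y) :
    IntervalIntegrable (fun y : ℝ => a * y⁻¹) volume c Y :=
  (intervalIntegrable_inv_iff.2 <| .inr <| notMem_uIcc_of_lt hc hY).const_mul a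

theorem intervalIntegral_mul_inv (a : ℝ) (hc : 0 < c) (hY : 0 < Y) :
    ∫ y in c..Y, a * y⁻¹ = a * Real.log (Y / c) := by
  rw [intervalIntegral.integral_const_mul, integral_inv_of_pos hc hY]

theorem integral_le_of_measureReal_lt_le_mul_inv [IsProbabilityMeasure μ] (hf : Integrable f μ)
    (hf0 : ∀ x, 0 ≤ f x) (hfY : ∀ x, f x ≤ Y) (hc : 0 < c) (hcY : c ≤ Y)
    (hb : ∀ y ∈ Ioo c Y, μ.real {x | y < f x} ≤ b * y⁻¹) :
    ∫ x, f x ∂μ ≤ c + b * Real.log (Y / c) := by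
  have hY : 0 < Y := hc.trans_le hcY
  have h_int (u v : ℝ) : IntervalIntegrable (fun y => μ.real {x | y < f x}) volume u v :=
    (antitone_measureReal_lt f).intervalIntegrable
  have hlow : ∫ y in 0..c, μ.real {x | y < f x} ≤ c := by
    simpa using intervalIntegral.integral_mono_on hc.le (h_int 0 c)
      (intervalIntegrable_const (c := (1 : ℝ))) fun _ _ => measureReal_le_one
  have hhigh := intervalIntegral.integral_mono_on_of_le_Ioo hcY (h_int c Y)
    (intervalIntegrable_mul_inv b hc hY) hb
  rw [intervalIntegral_mul_inv b hc hY] at hhigh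
  rw [integral_eq_intervalIntegral_measureReal_lt hf hf0 hY.le hfY,
    ← intervalIntegral.integral_add_adjacent_intervals (h_int 0 c) (h_int c Y)]
  exact add_le_add hlow hhigh

theorem le_integral_of_mul_inv_le_measureReal_lt [IsFiniteMeasure μ] (hf : Integrable f μ)
    (hf0 : ∀ x, 0 ≤ f x) (hfY : ∀ x, f x ≤ Y) (hc : 0 < c) (hcY : c ≤ Y)
    (ha : ∀ y ∈ Ioo c Y, a * y⁻¹ ≤ μ.real {x | y < f x}) :
    a * Real.log (Y / c) ≤ ∫ x, f x ∂μ := by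
  have hY : 0 < Y := hc.trans_le hcY
  have h_int (u v : ℝ) : IntervalIntegrable (fun y => μ.real {x | y < f x}) volume u v :=
    (antitone_measureReal_lt f).intervalIntegrable
  rw [integral_eq_intervalIntegral_measureReal_lt hf hf0 hY.le hfY,
    ← intervalIntegral.integral_add_adjacent_intervals (h_int 0 c) (h_int c Y),
    ← intervalIntegral_mul_inv a hc hY]
  refine le_add_of_nonneg_of_le (intervalIntegral.integral_nonneg hc.le fun _ _ =>
    measureReal_nonneg) ?_
  exact intervalIntegral.integral_mono_on_of_le_Ioo hcY (intervalIntegrable_mul_inv a hc hY)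
    (h_int c Y) ha

end LayerCake

section TruncDistPow

variable {X : Type*} [PseudoMetricSpace X] {κ s r₀ : ℝ} {K : Set X}

/-- The power `d_K ^ (-κ)` of the distance to `K`, with the distance truncated from below at `s`
so that the function stays bounded (by `s ^ (-κ)`) near `K`. -/
noncomputable def truncDistPow (κ s : ℝ) (K : Set X) (x : X) : ℝ :=
  max (Metric.infDist x K) s ^ (-κ)

theorem truncDistPow_nonneg (x : X) : 0 ≤ truncDistPow κ s K x :=
  Real.rpow_nonneg (Metric.infDist_nonneg.trans (le_max_left _ _)) _

theorem truncDistPow_le (hκ : 0 ≤ κ) (hs : 0 < s) (x : X) : truncDistPow κ s K x ≤ s ^ (-κ) :=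
  Real.rpow_le_rpow_of_nonpos hs (le_max_right _ _) (neg_nonpos.2 hκ)

theorem lipschitzOnWith_rpow_neg (hκ : 0 ≤ κ) (hs : 0 < s) :
    LipschitzOnWith (κ * s ^ (-κ - 1)).toNNReal (fun x : ℝ => x ^ (-κ)) (Ici s) := by
  refine (convex_Ici s).lipschitzOnWith_of_nnnorm_hasDerivWithin_le
    (fun x hx => (Real.hasDerivAt_rpow_const (.inl (hs.trans_le hx).ne')).hasDerivWithinAt)
    fun x hx => ?_
  rw [← NNReal.coe_le_coe, coe_nnnorm, Real.norm_eq_abs, abs_mul, abs_neg, abs_of_nonneg hκ,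
    abs_of_nonneg (Real.rpow_nonneg (hs.le.trans hx) _), Real.coe_toNNReal _ (by positivity)]
  exact mul_le_mul_of_nonneg_left (Real.rpow_le_rpow_of_nonpos hs hx (by linarith)) hκ

theorem lipschitzWith_truncDistPow (hκ : 0 ≤ κ) (hs : 0 < s) (K : Set X) :
    LipschitzWith (κ * s ^ (-κ - 1)).toNNReal (truncDistPow κ s K) := by
  rw [← mul_one (κ * s ^ (-κ - 1)).toNNReal, ← lipschitzOnWith_univ]
  exact (lipschitzOnWith_rpow_neg hκ hs).comp
    ((Metric.lipschitz_infDist_pt K).max_const s).lipschitzOnWith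
    fun _ _ => mem_Ici.2 (le_max_right _ _)

theorem continuous_truncDistPow (hκ : 0 ≤ κ) (hs : 0 < s) (K : Set X) :
    Continuous (truncDistPow κ s K) :=
  (lipschitzWith_truncDistPow hκ hs K).continuous

theorem integrable_truncDistPow [MeasurableSpace X] [OpensMeasurableSpace X] {μ : Measure X}
    [IsFiniteMeasure μ] (hκ : 0 ≤ κ) (hs : 0 < s) : Integrable (truncDistPow κ s K) μ :=
  .of_bound (continuous_truncDistPow hκ hs K).aestronglyMeasurable (s ^ (-κ)) <|
    .of_forall fun x => by
      rw [Real.norm_of_nonneg (truncDistPow_nonneg x)]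
      exact truncDistPow_le hκ hs x

theorem setOf_lt_truncDistPow (hκ : 0 < κ) (hs : 0 < s) (hK : K.Nonempty) {y : ℝ} (hy : 0 < y)
    (hys : y < s ^ (-κ)) : {x | y < truncDistPow κ s K x} = Metric.thickening (y ^ (-κ)⁻¹) K := by
  have hlt {d : ℝ} (hd : 0 < d) : y < d ^ (-κ) ↔ d < y ^ (-κ)⁻¹ :=
    (Real.lt_rpow_inv_iff_of_neg hd hy (neg_lt_zero.2 hκ)).symm
  ext x
  rw [mem_ofPred_eq, truncDistPow, hlt (lt_max_of_lt_right hs), max_lt_iff,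
    Metric.mem_thickening_iff_infDist_lt hK]
  exact and_iff_left ((hlt hs).1 hys)

theorem exists_setOf_lt_truncDistPow_eq_thickening (hκ : 0 < κ) (hs : 0 < s) (hr₀ : 0 < r₀)
    (hK : K.Nonempty) {y : ℝ} (hy : y ∈ Ioo (r₀ ^ (-κ)) (s ^ (-κ))) :
    ∃ r, 0 < r ∧ r ≤ r₀ ∧ r ^ κ = y⁻¹ ∧
      {x | y < truncDistPow κ s K x} = Metric.thickening r K := by
  have hy0 : 0 < y := (Real.rpow_pos_of_pos hr₀ _).trans hy.1
  refine ⟨y ^ (-κ)⁻¹, by positivity, ?_, ?_, setOf_lt_truncDistPow hκ hs hK hy0 hy.2⟩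
  · exact ((Real.rpow_inv_lt_iff_of_neg hy0 hr₀ (neg_lt_zero.2 hκ)).2 hy.1).le
  · rw [← Real.rpow_mul hy0.le, inv_neg, neg_mul, inv_mul_cancel₀ hκ.ne', Real.rpow_neg_one]

theorem log_rpow_neg_div_rpow_neg (hs : 0 < s) (hr₀ : 0 < r₀) :
    Real.log (s ^ (-κ) / r₀ ^ (-κ)) = κ * Real.log (r₀ / s) := by
  rw [← Real.div_rpow hs.le hr₀.le, Real.log_rpow (by positivity), ← inv_div r₀ s, Real.log_inv,
    neg_mul_neg]

variable [MeasurableSpace X] [OpensMeasurableSpace X] {μ : Measure X} {a b : ℝ}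

theorem integral_truncDistPow_le [IsProbabilityMeasure μ] (hκ : 0 < κ) (hs : 0 < s)
    (hsr : s ≤ r₀) (hK : K.Nonempty)
    (hb : ∀ r, 0 < r → r ≤ r₀ → μ.real (Metric.thickening r K) ≤ b * r ^ κ) :
    ∫ x, truncDistPow κ s K x ∂μ ≤ r₀ ^ (-κ) + b * (κ * Real.log (r₀ / s)) := by
  have hr₀ : 0 < r₀ := hs.trans_le hsr
  rw [← log_rpow_neg_div_rpow_neg hs hr₀]
  refine integral_le_of_measureReal_lt_le_mul_inv (integrable_truncDistPow hκ.le hs)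
    truncDistPow_nonneg (truncDistPow_le hκ.le hs) (by positivity)
    (Real.rpow_le_rpow_of_nonpos hs hsr (neg_nonpos.2 hκ.le)) fun y hy => ?_
  obtain ⟨r, hr, hrr, hry, hset⟩ := exists_setOf_lt_truncDistPow_eq_thickening hκ hs hr₀ hK hy
  rw [hset, ← hry]
  exact hb r hr hrr

theorem le_integral_truncDistPow [IsFiniteMeasure μ] (hκ : 0 < κ) (hs : 0 < s)
    (hsr : s ≤ r₀) (hK : K.Nonempty)
    (ha : ∀ r, 0 < r → r ≤ r₀ → a * r ^ κ ≤ μ.real (Metric.thickening r K)) :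
    a * (κ * Real.log (r₀ / s)) ≤ ∫ x, truncDistPow κ s K x ∂μ := by
  have hr₀ : 0 < r₀ := hs.trans_le hsr
  rw [← log_rpow_neg_div_rpow_neg hs hr₀]
  refine le_integral_of_mul_inv_le_measureReal_lt (integrable_truncDistPow hκ.le hs)
    truncDistPow_nonneg (truncDistPow_le hκ.le hs) (by positivity)
    (Real.rpow_le_rpow_of_nonpos hs hsr (neg_nonpos.2 hκ.le)) fun y hy => ?_
  obtain ⟨r, hr, hrr, hry, hset⟩ := exists_setOf_lt_truncDistPow_eq_thickening hκ hs hr₀ hK hy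
  rw [hset, ← hry]
  exact ha r hr hrr

end TruncDistPow

section CirclePoint

/-- The point `exp (2 π i t)` of the unit circle, as a complex number. -/
noncomputable abbrev circlePoint (t : SzegoCircle) : ℂ := (AddCircle.toCircle t : ℂ)

theorem norm_circlePoint (t : SzegoCircle) : ‖circlePoint t‖ = 1 := Circle.norm_coe _

theorem circlePoint_ne_zero (t : SzegoCircle) : circlePoint t ≠ 0 := Circle.coe_ne_zero _

theorem continuous_circlePoint : Continuous circlePoint :=
  continuous_subtype_val.comp AddCircle.continuous_toCircle

theorem injective_circlePoint : Function.Injective circlePoint :=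
  Circle.coe_injective.comp (AddCircle.injective_toCircle one_ne_zero)

theorem circlePoint_sub (s t : SzegoCircle) :
    circlePoint (s - t) = circlePoint s * (circlePoint t)⁻¹ := by
  rw [circlePoint, sub_eq_add_neg, AddCircle.toCircle_add, AddCircle.toCircle_neg, Circle.coe_mul,
    Circle.coe_inv]

theorem circlePoint_coe (x : ℝ) :
    circlePoint (x : SzegoCircle) = circleMap 0 1 (2 * Real.pi * x) := by
  simp [circlePoint, AddCircle.toCircle, circleMap]

theorem haarAddCircle_eq_volume : (haarAddCircle : Measure SzegoCircle) = volume := by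
  rw [AddCircle.volume_eq_smul_haarAddCircle, ENNReal.ofReal_one, one_smul]

theorem integral_comp_circlePoint {E : Type*} [NormedAddCommGroup E] [NormedSpace ℝ E]
    (f : ℂ → E) :
    ∫ t, f (circlePoint t) ∂haarAddCircle = Real.circleAverage f 0 1 := by
  rw [haarAddCircle_eq_volume, ← UnitAddCircle.intervalIntegral_preimage 0, Real.circleAverage_def]
  simp_rw [circlePoint_coe]
  rw [intervalIntegral.integral_comp_mul_left (fun x => f (circleMap 0 1 x)) (by positivity),
    mul_zero, zero_add, mul_one]

theorem integrable_comp_circlePoint {f : ℂ → ℝ} (hf : Measurable f)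
    (h_int : CircleIntegrable f 0 1) :
    Integrable (fun t => f (circlePoint t)) haarAddCircle := by
  have hmeas : Measurable fun t => f (circlePoint t) := hf.comp continuous_circlePoint.measurable
  rw [haarAddCircle_eq_volume, ← (UnitAddCircle.measurePreserving_mk 0).integrable_comp
    hmeas.aestronglyMeasurable]
  have h := IntervalIntegrable.comp_mul_left h_int (c := 2 * Real.pi)
  rw [zero_div, div_self (by positivity), intervalIntegrable_iff_integrableOn_Ioc_of_le zero_le_one]
    at h
  simpa only [Function.comp_def, circlePoint_coe, IntegrableOn, zero_add] using h

instance nullSingletonClass_haarAddCircle :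
    NullSingletonClass (haarAddCircle : Measure SzegoCircle) where
  measure_singleton t := by
    rw [haarAddCircle_eq_volume, ← Metric.closedBall_zero, AddCircle.volume_closedBall, mul_zero,
      min_eq_right zero_le_one, ENNReal.ofReal_zero]

theorem integrable_of_continuous {ρ : Measure SzegoCircle} [IsFiniteMeasure ρ] {E : Type*}
    [NormedAddCommGroup E] {f : SzegoCircle → E} (hf : Continuous f) : Integrable f ρ :=
  hf.integrable_of_hasCompactSupport (HasCompactSupport.of_compactSpace f)

theorem exists_coe_eq_and_abs_eq_norm (t : SzegoCircle) :
    ∃ x : ℝ, (x : SzegoCircle) = t ∧ |x| = ‖t‖ := by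
  obtain ⟨y, rfl⟩ := QuotientAddGroup.mk_surjective t
  refine ⟨y - round y, ?_, UnitAddCircle.norm_eq.symm⟩
  rw [AddCircle.coe_sub, sub_eq_self]
  exact (AddCircle.coe_eq_zero_iff 1).2 ⟨round y, by simp⟩

theorem norm_le_half (t : SzegoCircle) : ‖t‖ ≤ 1 / 2 := by
  simpa using AddCircle.norm_le_half_period 1 (x := t) one_ne_zero

theorem four_mul_norm_le_norm_circlePoint_sub_one (t : SzegoCircle) :
    4 * ‖t‖ ≤ ‖circlePoint t - 1‖ := by
  obtain ⟨x, rfl, hx⟩ := exists_coe_eq_and_abs_eq_norm t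
  have hhalf := norm_le_half (x : SzegoCircle)
  have hexp : circlePoint (x : SzegoCircle) =
      Complex.exp (Complex.I * ((2 * (Real.pi * x) : ℝ) : ℂ)) := by
    rw [circlePoint_coe, circleMap_zero, ← mul_assoc, Complex.ofReal_one, one_mul, mul_comm]
  have habs : |Real.pi * x| = Real.pi * |x| := by rw [abs_mul, abs_of_pos Real.pi_pos]
  have hsin : 2 / Real.pi * (Real.pi * |x|) ≤ |Real.sin (Real.pi * x)| := by
    rw [← habs]
    refine Real.mul_abs_le_abs_sin ?_
    rw [habs, hx]
    nlinarith [Real.pi_pos]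
  rw [← mul_assoc, div_mul_cancel₀ _ Real.pi_ne_zero] at hsin
  rw [hexp, Complex.norm_exp_I_mul_ofReal_sub_one, mul_div_cancel_left₀ _ two_ne_zero, norm_mul,
    Real.norm_two, Real.norm_eq_abs, ← hx]
  linarith

end CirclePoint

section PolynomialOnCircle

variable {P : ℂ[X]}

theorem continuous_norm_eval_circlePoint_sq (P : ℂ[X]) :
    Continuous fun t => ‖P.eval (circlePoint t)‖ ^ 2 :=
  (P.continuous.comp continuous_circlePoint).norm.pow 2

theorem ae_eval_circlePoint_ne_zero (hP : P ≠ 0) :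
    ∀ᵐ t ∂haarAddCircle, P.eval (circlePoint t) ≠ 0 := by
  have hfin : {t | P.eval (circlePoint t) = 0}.Finite :=
    (finite_setOfPred_isRoot hP).preimage injective_circlePoint.injOn
  exact compl_mem_ae_iff.2 (hfin.measure_zero _)

theorem integrable_log_norm_eval_circlePoint (P : ℂ[X]) :
    Integrable (fun t => Real.log ‖P.eval (circlePoint t)‖) haarAddCircle :=
  integrable_comp_circlePoint (f := fun z => Real.log ‖P.eval z‖)
    (Real.measurable_log.comp P.continuous.norm.measurable) P.intervalIntegrable_mahlerMeasure

theorem integral_log_norm_eval_nonneg (hP : P.Monic) :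
    0 ≤ ∫ t, Real.log ‖P.eval (circlePoint t)‖ ∂haarAddCircle := by
  rw [integral_comp_circlePoint fun z => Real.log ‖P.eval z‖, ← logMahlerMeasure_def,
    logMahlerMeasure_eq_log_MahlerMeasure]
  refine Real.log_nonneg (one_le_mahlerMeasure_of_one_le_norm_leadingCoeff ?_)
  rw [hP.leadingCoeff, norm_one]

theorem norm_eval_circlePoint_sq_le_integral (P : ℂ[X]) (t : SzegoCircle) :
    ‖P.eval (circlePoint t)‖ ^ 2 ≤
      (P.natDegree + 1) * ∫ τ, ‖P.eval (circlePoint τ)‖ ^ 2 ∂haarAddCircle := by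
  rw [integral_comp_circlePoint fun z => ‖P.eval z‖ ^ 2, ← P.sum_sq_norm_coeff_eq_circleAverage]
  have hnorm : ‖P.eval (circlePoint t)‖ ≤ ∑ i ∈ P.support, ‖P.coeff i‖ := by
    rw [eval_eq_sum, Polynomial.sum]
    refine (norm_sum_le _ _).trans_eq (Finset.sum_congr rfl fun i _ => ?_)
    rw [norm_mul, norm_pow, norm_circlePoint, one_pow, mul_one]
  calc ‖P.eval (circlePoint t)‖ ^ 2
      ≤ (∑ i ∈ P.support, ‖P.coeff i‖) ^ 2 := by gcongr
    _ ≤ P.support.card * ∑ i ∈ P.support, ‖P.coeff i‖ ^ 2 := sq_sum_le_card_mul_sum_sq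
    _ ≤ (P.natDegree + 1) * ∑ i ∈ P.support, ‖P.coeff i‖ ^ 2 := by
      gcongr
      exact_mod_cast P.card_supp_le_succ_natDegree

theorem integral_eval_circlePoint (P : ℂ[X]) :
    ∫ t, P.eval (circlePoint t) ∂haarAddCircle = P.eval 0 := by
  rw [integral_comp_circlePoint fun z => P.eval z]
  exact P.differentiable.diffContOnCl.circleAverage

end PolynomialOnCircle

section SzegoMin

variable {ρ ρ' : Measure SzegoCircle} {n : ℕ} {P Q : ℂ[X]}

theorem szegoMin_le_of_monic (ρ : Measure SzegoCircle) (hP : P.Monic) :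
    szegoMin ρ P.natDegree ≤ √(∫ t, ‖P.eval (circlePoint t)‖ ^ 2 ∂ρ) := by
  have heval (z : ℂ) : P.eval z =
      (∑ j : Fin P.natDegree, P.coeff j * z ^ (j : ℕ)) + z ^ P.natDegree := by
    rw [Fin.sum_univ_eq_sum_range fun j => P.coeff j * z ^ j, eval_eq_sum_range,
      Finset.sum_range_succ, hP.coeff_natDegree, one_mul]
  simp only [heval]
  refine ciInf_le (f := fun q : Fin P.natDegree → ℂ => √(∫ t, ‖(∑ j, q j * circlePoint t ^ (j : ℕ))
    + circlePoint t ^ P.natDegree‖ ^ 2 ∂ρ)) ⟨0, ?_⟩ fun j => P.coeff j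
  rintro _ ⟨q, rfl⟩
  exact Real.sqrt_nonneg _

theorem le_szegoMin {c : ℝ} (h : ∀ P : ℂ[X], P.Monic → P.natDegree = n →
    c ≤ √(∫ t, ‖P.eval (circlePoint t)‖ ^ 2 ∂ρ)) : c ≤ szegoMin ρ n := by
  refine le_ciInf fun q => ?_
  have hdeg := degree_sum_fin_lt q
  refine (h (X ^ n + ∑ j : Fin n, C (q j) * X ^ (j : ℕ)) (monic_X_pow_add hdeg)
    (natDegree_eq_of_degree_eq_some ?_)).trans_eq ?_
  · rw [degree_add_eq_left_of_degree_lt (by rwa [degree_X_pow]), degree_X_pow]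
  · simp only [eval_add, eval_finsetSum, eval_mul, eval_C, eval_pow, eval_X, add_comm]

theorem szegoMin_mono [IsFiniteMeasure ρ'] (h : ρ ≤ ρ') (n : ℕ) :
    szegoMin ρ n ≤ szegoMin ρ' n := by
  refine le_szegoMin fun P hP hdeg => hdeg ▸ (szegoMin_le_of_monic ρ hP).trans ?_
  refine Real.sqrt_le_sqrt (integral_mono_measure h (.of_forall fun t => sq_nonneg _) ?_)
  exact integrable_of_continuous (continuous_norm_eval_circlePoint_sq P)

/-- The reversed polynomial `z ^ n * Q (z⁻¹)` is monic of degree `n` as soon as `Q 0 = 1`. -/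
theorem szegoMin_le_of_coeff_zero_eq_one (ρ : Measure SzegoCircle) (hdeg : Q.natDegree ≤ n)
    (h0 : Q.coeff 0 = 1) :
    szegoMin ρ n ≤ √(∫ t, ‖Q.eval (circlePoint t)⁻¹‖ ^ 2 ∂ρ) := by
  have hle : (Q.reflect n).natDegree ≤ n := natDegree_reflect_le.trans (max_le le_rfl hdeg)
  have hcoeff : (Q.reflect n).coeff n = 1 := by
    rw [coeff_reflect, revAt_le le_rfl, Nat.sub_self, h0]
  have hnatDegree : (Q.reflect n).natDegree = n :=
    natDegree_eq_of_le_of_coeff_ne_zero hle (hcoeff ▸ one_ne_zero)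
  have heval (t : SzegoCircle) :
      ‖(Q.reflect n).eval (circlePoint t)‖ = ‖Q.eval (circlePoint t)⁻¹‖ := by
    let _ : Invertible (circlePoint t)⁻¹ :=
      invertibleOfNonzero (inv_ne_zero (circlePoint_ne_zero t))
    have h := eval₂_reflect_mul_pow (RingHom.id ℂ) (circlePoint t)⁻¹ n Q hdeg
    rw [invOf_eq_inv, inv_inv, eval₂_id, eval₂_id] at h
    rw [← h, norm_mul, norm_pow, norm_inv, norm_circlePoint, inv_one, one_pow, mul_one]
  have h := szegoMin_le_of_monic ρ (monic_of_natDegree_le_of_coeff_eq_one n hle hcoeff)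
  simpa only [hnatDegree, heval] using h

end SzegoMin

section ExpWeight

variable {v : SzegoCircle → ℝ} {E : Set SzegoCircle} {M : ℝ} {n : ℕ} {P : ℂ[X]}

/-- The measure `exp (-v) dm` on the circle. -/
noncomputable def expWeight (v : SzegoCircle → ℝ) : Measure SzegoCircle :=
  haarAddCircle.withDensity fun t => ENNReal.ofReal (Real.exp (-v t))

theorem continuous_exp_neg (hv : Continuous v) : Continuous fun t => Real.exp (-v t) :=
  hv.neg.rexp

theorem isFiniteMeasure_expWeight (hv : Continuous v) : IsFiniteMeasure (expWeight v) :=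
  isFiniteMeasure_withDensity_ofReal
    (integrable_of_continuous (ρ := haarAddCircle) (continuous_exp_neg hv)).hasFiniteIntegral

theorem setIntegral_expWeight (hv : Continuous v) (hE : MeasurableSet E) (f : SzegoCircle → ℝ) :
    ∫ t in E, f t ∂expWeight v = ∫ t in E, Real.exp (-v t) * f t ∂haarAddCircle := by
  rw [expWeight, setIntegral_withDensity_eq_setIntegral_toReal_smul
    (continuous_exp_neg hv).measurable.ennreal_ofReal
    (.of_forall fun _ => ENNReal.ofReal_lt_top) f hE]
  simp only [ENNReal.toReal_ofReal (Real.exp_pos _).le, smul_eq_mul]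

theorem integral_expWeight (hv : Continuous v) (f : SzegoCircle → ℝ) :
    ∫ t, f t ∂expWeight v = ∫ t, Real.exp (-v t) * f t ∂haarAddCircle := by
  simpa only [setIntegral_univ] using setIntegral_expWeight hv .univ f

theorem exp_neg_integral_le_integral_expWeight (hv : Continuous v) (hP : P.Monic) :
    Real.exp (-∫ t, v t ∂haarAddCircle) ≤ ∫ t, ‖P.eval (circlePoint t)‖ ^ 2 ∂expWeight v := by
  let g (t : SzegoCircle) : ℝ := -v t + 2 * Real.log ‖P.eval (circlePoint t)‖
  have hlog := (integrable_log_norm_eval_circlePoint P).const_mul 2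
  have hv_int : Integrable v haarAddCircle := integrable_of_continuous hv
  have hg : Integrable g haarAddCircle := hv_int.neg.add hlog
  have hexp : (fun t => Real.exp (g t)) =ᵐ[haarAddCircle]
      fun t => Real.exp (-v t) * ‖P.eval (circlePoint t)‖ ^ 2 := by
    filter_upwards [ae_eval_circlePoint_ne_zero hP.ne_zero] with t ht
    rw [Real.exp_add, two_mul, Real.exp_add, Real.exp_log (norm_pos_iff.2 ht), sq]
  have hexp_int : Integrable (fun t => Real.exp (g t)) haarAddCircle :=
    (integrable_of_continuous
      ((continuous_exp_neg hv).mul (continuous_norm_eval_circlePoint_sq P))).congr hexp.symm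
  calc Real.exp (-∫ t, v t ∂haarAddCircle)
      ≤ Real.exp (∫ t, g t ∂haarAddCircle) := by
        have h_int : ∫ t, g t ∂haarAddCircle = -∫ t, v t ∂haarAddCircle +
            2 * ∫ t, Real.log ‖P.eval (circlePoint t)‖ ∂haarAddCircle := by
          rw [← integral_neg, ← integral_const_mul]
          exact integral_add hv_int.neg hlog
        rw [h_int]
        gcongr
        linarith [integral_log_norm_eval_nonneg hP]
    _ ≤ ∫ t, Real.exp (g t) ∂haarAddCircle :=
        convexOn_exp.map_integral_le Real.continuous_exp.continuousOn isClosed_univ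
          (.of_forall fun _ => mem_univ _) hg hexp_int
    _ = ∫ t, ‖P.eval (circlePoint t)‖ ^ 2 ∂expWeight v := by
        rw [integral_congr_ae hexp, integral_expWeight hv]

theorem setIntegral_norm_eval_sq_le_compl (hE : MeasurableSet E)
    (hsmall : haarAddCircle.real E * (P.natDegree + 1) ≤ 1 / 2) :
    ∫ t in E, ‖P.eval (circlePoint t)‖ ^ 2 ∂haarAddCircle ≤
      ∫ t in Eᶜ, ‖P.eval (circlePoint t)‖ ^ 2 ∂haarAddCircle := by
  let S := ∫ t, ‖P.eval (circlePoint t)‖ ^ 2 ∂haarAddCircle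
  have h_int : Integrable (fun t => ‖P.eval (circlePoint t)‖ ^ 2) haarAddCircle :=
    integrable_of_continuous (continuous_norm_eval_circlePoint_sq P)
  have hS : 0 ≤ S := integral_nonneg fun _ => sq_nonneg _
  have hhalf : ∫ t in E, ‖P.eval (circlePoint t)‖ ^ 2 ∂haarAddCircle ≤ 1 / 2 * S := calc
    _ ≤ ∫ _ in E, (P.natDegree + 1) * S ∂haarAddCircle :=
        setIntegral_mono h_int.integrableOn (integrable_const _).integrableOn
          (norm_eval_circlePoint_sq_le_integral P)
    _ = haarAddCircle.real E * (P.natDegree + 1) * S := by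
        rw [setIntegral_const, smul_eq_mul, mul_assoc]
    _ ≤ 1 / 2 * S := mul_le_mul_of_nonneg_right hsmall hS
  linarith [integral_add_compl hE h_int]

theorem setIntegral_expWeight_le_compl (hv : Continuous v) (hE : MeasurableSet E)
    (hsmall : haarAddCircle.real E * (P.natDegree + 1) ≤ 1 / 2)
    (hin : ∀ t ∈ E, M ≤ v t) (hout : ∀ t ∉ E, v t ≤ M) :
    ∫ t in E, ‖P.eval (circlePoint t)‖ ^ 2 ∂expWeight v ≤
      ∫ t in Eᶜ, ‖P.eval (circlePoint t)‖ ^ 2 ∂expWeight v := by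
  have hcont := continuous_norm_eval_circlePoint_sq P
  have hconst : Integrable (fun t => Real.exp (-M) * ‖P.eval (circlePoint t)‖ ^ 2)
      haarAddCircle := integrable_of_continuous (continuous_const.mul hcont)
  have hweight : Integrable (fun t => Real.exp (-v t) * ‖P.eval (circlePoint t)‖ ^ 2)
      haarAddCircle := integrable_of_continuous ((continuous_exp_neg hv).mul hcont)
  rw [setIntegral_expWeight hv hE, setIntegral_expWeight hv hE.compl]
  calc ∫ t in E, Real.exp (-v t) * ‖P.eval (circlePoint t)‖ ^ 2 ∂haarAddCircle
      ≤ ∫ t in E, Real.exp (-M) * ‖P.eval (circlePoint t)‖ ^ 2 ∂haarAddCircle :=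
        setIntegral_mono_on hweight.integrableOn hconst.integrableOn hE fun t ht => by
          gcongr; exact hin t ht
    _ ≤ ∫ t in Eᶜ, Real.exp (-M) * ‖P.eval (circlePoint t)‖ ^ 2 ∂haarAddCircle := by
        simp only [integral_const_mul]
        exact mul_le_mul_of_nonneg_left (setIntegral_norm_eval_sq_le_compl hE hsmall)
          (Real.exp_pos _).le
    _ ≤ ∫ t in Eᶜ, Real.exp (-v t) * ‖P.eval (circlePoint t)‖ ^ 2 ∂haarAddCircle :=
        setIntegral_mono_on hconst.integrableOn hweight.integrableOn hE.compl fun t ht => by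
          gcongr; exact hout t ht

theorem sqrt_exp_neg_integral_le_szegoMin_restrict_compl (hv : Continuous v)
    (hE : MeasurableSet E) (hsmall : haarAddCircle.real E * (n + 1) ≤ 1 / 2)
    (hin : ∀ t ∈ E, M ≤ v t) (hout : ∀ t ∉ E, v t ≤ M) :
    √(Real.exp (-∫ t, v t ∂haarAddCircle) / 2) ≤ szegoMin ((expWeight v).restrict Eᶜ) n := by
  refine le_szegoMin fun P hP hdeg => Real.sqrt_le_sqrt ?_
  subst hdeg
  have := isFiniteMeasure_expWeight hv
  have hsplit := integral_add_compl hE (integrable_of_continuous (ρ := expWeight v)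
    (continuous_norm_eval_circlePoint_sq P))
  linarith [exp_neg_integral_le_integral_expWeight hv hP,
    setIntegral_expWeight_le_compl hv hE hsmall hin hout]

end ExpWeight

section FejerKernel

variable {N : ℕ} {z : ℂ}

/-- The analytic polynomial `1 + 2 * ∑ (1 - k / N) * X ^ k`, `0 < k < N`, whose real part on the
unit circle is the Fejér kernel `N⁻¹ * ‖1 + z + ⋯ + z ^ (N - 1)‖ ^ 2`. -/
noncomputable def analyticFejer (N : ℕ) : ℂ[X] :=
  C (N : ℂ)⁻¹ * ∑ j ∈ Finset.range N, (1 + 2 * ∑ i ∈ Finset.range j, X ^ (i + 1))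

theorem eval_analyticFejer (N : ℕ) (z : ℂ) : (analyticFejer N).eval z =
    (N : ℂ)⁻¹ * ∑ j ∈ Finset.range N, (1 + 2 * ∑ i ∈ Finset.range j, z ^ (i + 1)) := by
  simp only [analyticFejer, eval_mul, eval_C, eval_finsetSum, eval_add, eval_one, eval_ofNat,
    eval_pow, eval_X]

theorem eval_zero_analyticFejer (hN : N ≠ 0) : (analyticFejer N).eval 0 = 1 := by
  simp [eval_analyticFejer, hN]

theorem natDegree_analyticFejer_le (N : ℕ) : (analyticFejer N).natDegree ≤ N := by
  refine (natDegree_C_mul_le _ _).trans (natDegree_sum_le_of_forall_le _ _ fun j hj => ?_)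
  rw [← C_ofNat, ← C_1]
  refine natDegree_C_add.trans_le <| (natDegree_C_mul_le _ _).trans <|
    natDegree_sum_le_of_forall_le _ _ fun i hi => ?_
  rw [natDegree_X_pow]
  exact (Finset.mem_range.1 hi).trans (Finset.mem_range.1 hj)

theorem norm_eval_analyticFejer_le (N : ℕ) (hz : ‖z‖ = 1) : ‖(analyticFejer N).eval z‖ ≤ N := by
  have hterm (j : ℕ) : ‖1 + 2 * ∑ i ∈ Finset.range j, z ^ (i + 1)‖ ≤ 1 + 2 * j := by
    refine (norm_add_le _ _).trans ?_
    rw [norm_one, norm_mul, Complex.norm_ofNat]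
    gcongr
    simpa [hz] using norm_sum_le (Finset.range j) fun i => z ^ (i + 1)
  have hsum (M : ℕ) : ∑ j ∈ Finset.range M, (1 + 2 * (j : ℝ)) = M * M := by
    induction M with
    | zero => simp
    | succ M ih => rw [Finset.sum_range_succ, ih]; push_cast; ring
  calc ‖(analyticFejer N).eval z‖
      ≤ (N : ℝ)⁻¹ * ∑ j ∈ Finset.range N, (1 + 2 * (j : ℝ)) := by
        rw [eval_analyticFejer, norm_mul, norm_inv, Complex.norm_natCast]
        gcongr
        exact (norm_sum_le _ _).trans (Finset.sum_le_sum fun j _ => hterm j)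
    _ = N := by rw [hsum, ← mul_assoc, inv_mul_mul_self]

theorem re_sum_one_add_two_mul_sum_pow (N : ℕ) (hz : ‖z‖ = 1) :
    (∑ j ∈ Finset.range N, (1 + 2 * ∑ i ∈ Finset.range j, z ^ (i + 1))).re =
      ‖∑ k ∈ Finset.range N, z ^ k‖ ^ 2 := by
  induction N with
  | zero => simp
  | succ N ih =>
    have hshift : ∑ i ∈ Finset.range N, z ^ (i + 1) = z * ∑ k ∈ Finset.range N, z ^ k := by
      simp only [Finset.mul_sum, pow_succ']
    have hnorm : ‖∑ k ∈ Finset.range N, z ^ k‖ = ‖z * ∑ k ∈ Finset.range N, z ^ k‖ := by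
      rw [norm_mul, hz, one_mul]
    rw [Finset.sum_range_succ, Complex.add_re, ih, Finset.sum_range_succ', hshift, hnorm, pow_zero,
      ← Complex.normSq_eq_norm_sq, ← Complex.normSq_eq_norm_sq, Complex.normSq_add]
    simp only [map_mul, Complex.add_re, Complex.one_re, Complex.mul_re, Complex.re_ofNat,
      Complex.im_ofNat, Complex.mul_im, zero_mul, sub_zero, map_one, mul_one]
    ring

theorem re_eval_analyticFejer (N : ℕ) (hz : ‖z‖ = 1) :
    ((analyticFejer N).eval z).re = (N : ℝ)⁻¹ * ‖∑ k ∈ Finset.range N, z ^ k‖ ^ 2 := by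
  rw [eval_analyticFejer, ← re_sum_one_add_two_mul_sum_pow N hz, ← Complex.ofReal_natCast,
    ← Complex.ofReal_inv, Complex.re_ofReal_mul]

/-- The Fejér kernel on the circle, a nonnegative kernel of integral `1` concentrated near `0`. -/
noncomputable def fejerKernel (N : ℕ) (t : SzegoCircle) : ℝ :=
  ((analyticFejer N).eval (circlePoint t)).re

theorem continuous_fejerKernel (N : ℕ) : Continuous (fejerKernel N) :=
  Complex.continuous_re.comp ((analyticFejer N).continuous.comp continuous_circlePoint)

theorem fejerKernel_nonneg (N : ℕ) (t : SzegoCircle) : 0 ≤ fejerKernel N t := by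
  rw [fejerKernel, re_eval_analyticFejer N (norm_circlePoint t)]
  positivity

theorem integral_fejerKernel (hN : N ≠ 0) : ∫ t, fejerKernel N t ∂haarAddCircle = 1 := by
  have h_int : Integrable (fun t => (analyticFejer N).eval (circlePoint t)) haarAddCircle :=
    integrable_of_continuous ((analyticFejer N).continuous.comp continuous_circlePoint)
  have h := integral_re h_int
  rw [integral_eval_circlePoint, eval_zero_analyticFejer hN] at h
  exact h.trans Complex.one_re

theorem fejerKernel_mul_norm_sq_le (N : ℕ) (t : SzegoCircle) :
    fejerKernel N t * ‖t‖ ^ 2 ≤ 1 / (4 * N) := by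
  have hz := norm_circlePoint t
  have hgeom : ‖∑ k ∈ Finset.range N, circlePoint t ^ k‖ * ‖circlePoint t - 1‖ ≤ 2 := by
    rw [← norm_mul, geom_sum_mul]
    refine (norm_sub_le _ _).trans_eq ?_
    rw [norm_pow, hz, one_pow, norm_one, one_add_one_eq_two]
  have hprod : ‖∑ k ∈ Finset.range N, circlePoint t ^ k‖ * ‖t‖ ≤ 1 / 2 := by
    have := mul_le_mul_of_nonneg_left (four_mul_norm_le_norm_circlePoint_sub_one t)
      (norm_nonneg (∑ k ∈ Finset.range N, circlePoint t ^ k))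
    linarith
  calc fejerKernel N t * ‖t‖ ^ 2
      = (N : ℝ)⁻¹ * (‖∑ k ∈ Finset.range N, circlePoint t ^ k‖ * ‖t‖) ^ 2 := by
        rw [fejerKernel, re_eval_analyticFejer N hz, mul_pow, mul_assoc]
    _ ≤ (N : ℝ)⁻¹ * (1 / 2) ^ 2 := by gcongr
    _ = 1 / (4 * N) := by field_simp; norm_num

end FejerKernel

section CircleConv

variable {A : ℂ[X]} {v : SzegoCircle → ℝ}

/-- The convolution of `v` with `A` on the circle, `t ↦ ∫ v τ * A (τ - t) dτ`, as a polynomial in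
`(circlePoint t)⁻¹`. -/
noncomputable def circleConv (A : ℂ[X]) (v : SzegoCircle → ℝ) : ℂ[X] :=
  ∑ k ∈ Finset.range (A.natDegree + 1),
    C (A.coeff k * ∫ τ, (v τ : ℂ) * circlePoint τ ^ k ∂haarAddCircle) * X ^ k

theorem natDegree_circleConv_le (A : ℂ[X]) (v : SzegoCircle → ℝ) :
    (circleConv A v).natDegree ≤ A.natDegree :=
  natDegree_sum_le_of_forall_le _ _ fun _ hk =>
    (natDegree_C_mul_X_pow_le _ _).trans (Nat.lt_succ_iff.1 (Finset.mem_range.1 hk))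

theorem eval_zero_circleConv (A : ℂ[X]) (v : SzegoCircle → ℝ) :
    (circleConv A v).eval 0 = A.coeff 0 * (∫ τ, v τ ∂haarAddCircle : ℝ) := by
  simp [circleConv, eval_finsetSum, Finset.sum_range_succ', integral_complex_ofReal]

theorem eval_circleConv (A : ℂ[X]) (hv : Continuous v) (t : SzegoCircle) :
    (circleConv A v).eval (circlePoint t)⁻¹ =
      ∫ τ, (v τ : ℂ) * A.eval (circlePoint (τ - t)) ∂haarAddCircle := by
  have h_int (k : ℕ) : Integrable (fun τ => (v τ : ℂ) * (A.coeff k * circlePoint (τ - t) ^ k))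
      haarAddCircle := integrable_of_continuous <| (Complex.continuous_ofReal.comp hv).mul <|
    continuous_const.mul <| (continuous_circlePoint.comp (continuous_sub_right t)).pow k
  simp only [eval_eq_sum_range (p := A), Finset.mul_sum]
  rw [integral_finsetSum _ fun k _ => h_int k, circleConv, eval_finsetSum]
  refine Finset.sum_congr rfl fun k _ => ?_
  simp only [eval_mul, eval_C, eval_pow, eval_X]
  rw [mul_assoc, ← integral_mul_const, ← integral_const_mul]
  refine integral_congr_ae (.of_forall fun τ => ?_)
  simp only [circlePoint_sub, mul_pow]
  ring

theorem continuous_ofReal_mul_eval_circlePoint_sub (A : ℂ[X]) (hv : Continuous v)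
    (t : SzegoCircle) : Continuous fun τ => (v τ : ℂ) * A.eval (circlePoint (τ - t)) :=
  (Complex.continuous_ofReal.comp hv).mul <|
    A.continuous.comp (continuous_circlePoint.comp (continuous_sub_right t))

theorem norm_eval_circleConv_le (hv : Continuous v) {V S : ℝ} (hV : ∀ t, |v t| ≤ V)
    (hA : ∀ z : ℂ, ‖z‖ = 1 → ‖A.eval z‖ ≤ S) (t : SzegoCircle) :
    ‖(circleConv A v).eval (circlePoint t)⁻¹‖ ≤ V * S := by
  rw [eval_circleConv A hv]
  refine (norm_integral_le_of_norm_le_const (C := V * S) (.of_forall fun τ => ?_)).trans_eq ?_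
  · rw [norm_mul, Complex.norm_real]
    exact mul_le_mul (hV τ) (hA _ (norm_circlePoint _)) (norm_nonneg _)
      ((abs_nonneg _).trans (hV τ))
  · rw [probReal_univ, mul_one]

theorem re_eval_circleConv (A : ℂ[X]) (hv : Continuous v) (t : SzegoCircle) :
    ((circleConv A v).eval (circlePoint t)⁻¹).re =
      ∫ τ, v τ * (A.eval (circlePoint (τ - t))).re ∂haarAddCircle := by
  have h_int : Integrable (fun τ => (v τ : ℂ) * A.eval (circlePoint (τ - t))) haarAddCircle :=
    integrable_of_continuous (continuous_ofReal_mul_eval_circlePoint_sub A hv t)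
  rw [eval_circleConv A hv]
  refine (integral_re h_int).symm.trans ?_
  simp only [RCLike.re_eq_complex_re, Complex.re_ofReal_mul]

end CircleConv

section ExpWeightUpperBound

open scoped NNReal

variable {u w : SzegoCircle → ℝ} {N J n : ℕ} {V δ : ℝ} {L : ℝ≥0}

theorem integral_mul_kernel_le {R : SzegoCircle → ℝ} (hRc : Continuous R) (hR : ∀ t, 0 ≤ R t)
    (hR1 : ∫ t, R t ∂haarAddCircle = 1) (hRδ : ∀ t, R t * ‖t‖ ^ 2 ≤ δ) (hw : LipschitzWith L w)
    (t : SzegoCircle) :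
    ∫ τ, w τ * R (τ - t) ∂haarAddCircle ≤ w t + 1 / 2 + L ^ 2 * δ / 2 := by
  have hRt : Continuous fun τ => R (τ - t) := hRc.comp (continuous_sub_right t)
  have hpoint (τ : SzegoCircle) :
      w τ * R (τ - t) ≤ (w t + 1 / 2) * R (τ - t) + L ^ 2 * δ / 2 := by
    have hlip : w τ ≤ w t + L * ‖τ - t‖ := dist_eq_norm τ t ▸ hw.le_add_mul τ t
    have hamgm : L * ‖τ - t‖ ≤ 1 / 2 + L ^ 2 * ‖τ - t‖ ^ 2 / 2 := by
      nlinarith [sq_nonneg (L * ‖τ - t‖ - 1)]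
    have hδ := mul_le_mul_of_nonneg_left (hRδ (τ - t)) (sq_nonneg (L : ℝ))
    have hmul := mul_le_mul_of_nonneg_right (hlip.trans (add_le_add_right hamgm _)) (hR (τ - t))
    linarith
  have hRt1 : ∫ τ, R (τ - t) ∂haarAddCircle = 1 := by
    rw [integral_sub_right_eq_self (μ := haarAddCircle) R t, hR1]
  refine (integral_mono (integrable_of_continuous (hw.continuous.mul hRt))
    (integrable_of_continuous (by fun_prop)) hpoint).trans_eq ?_
  rw [integral_add (integrable_of_continuous (by fun_prop)) (integrable_const _),
    integral_const_mul, hRt1, mul_one, integral_const, probReal_univ, one_smul]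

theorem re_eval_circleConv_analyticFejer_le (hN : N ≠ 0) (hw : LipschitzWith L w)
    (hL : (L : ℝ) ^ 2 ≤ 4 * N) (t : SzegoCircle) :
    ((circleConv (analyticFejer N) w).eval (circlePoint t)⁻¹).re ≤ w t + 1 := by
  have hbound : (L : ℝ) ^ 2 * (1 / (4 * N)) ≤ 1 := by
    rw [mul_one_div]
    exact div_le_one_of_le₀ hL (by positivity)
  rw [re_eval_circleConv _ hw.continuous]
  refine (integral_mul_kernel_le (continuous_fejerKernel N) (fejerKernel_nonneg N)
    (integral_fejerKernel hN) (fejerKernel_mul_norm_sq_le N) hw t).trans ?_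
  linarith

theorem pow_div_factorial_le_exp_neg {B : ℝ} (hB : 0 ≤ B) (hJ : 4 * B ≤ J) :
    B ^ J / J.factorial ≤ Real.exp (-B) := by
  have h := Real.pow_div_factorial_le_exp (x := Real.exp 1 * B) (by positivity) J
  rw [mul_pow, ← Real.exp_nat_mul, mul_one, mul_div_assoc, ← le_div_iff₀' (Real.exp_pos _),
    ← Real.exp_sub] at h
  exact h.trans (Real.exp_le_exp.2 (by nlinarith [Real.exp_one_lt_d9]))

theorem norm_exp_sub_sum_le_two_mul_exp_neg {g : ℂ} {B : ℝ} (hg : ‖g‖ ≤ B) (hJ : 4 * B ≤ J) :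
    ‖Complex.exp g - ∑ j ∈ Finset.range J, g ^ j / (j.factorial : ℂ)‖ ≤ 2 * Real.exp (-B) := by
  have hB : 0 ≤ B := (norm_nonneg g).trans hg
  refine (Complex.exp_bound' ?_).trans ?_
  · rw [div_le_iff₀ (by positivity)]
    push_cast
    linarith
  · rw [mul_comm]
    gcongr
    exact (by gcongr : ‖g‖ ^ J / J.factorial ≤ B ^ J / J.factorial).trans
      (pow_div_factorial_le_exp_neg hB hJ)

/-- The `J`-th Taylor polynomial `∑ H ^ j / j!`, `j < J`, of `exp H`. -/
noncomputable def expTrunc (J : ℕ) (H : ℂ[X]) : ℂ[X] :=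
  ((PowerSeries.exp ℂ).trunc J).comp H

theorem eval_expTrunc (J : ℕ) (H : ℂ[X]) (z : ℂ) :
    (expTrunc J H).eval z = ∑ j ∈ Finset.range J, H.eval z ^ j / (j.factorial : ℂ) := by
  rw [expTrunc, eval_comp, ← eval₂_id, PowerSeries.eval₂_trunc_eq_sum_range]
  simp [PowerSeries.coeff_exp, div_eq_inv_mul]

theorem natDegree_expTrunc_le {H : ℂ[X]} (hJ : J ≠ 0) (hH : H.natDegree ≤ N) :
    (expTrunc J H).natDegree ≤ J * N := by
  obtain ⟨J, rfl⟩ := Nat.exists_eq_succ_of_ne_zero hJ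
  rw [expTrunc, natDegree_comp]
  exact Nat.mul_le_mul (PowerSeries.natDegree_trunc_lt _ J).le hH

theorem coeff_zero_expTrunc {H : ℂ[X]} (hJ : J ≠ 0) (hH : H.eval 0 = 0) :
    (expTrunc J H).coeff 0 = 1 := by
  obtain ⟨J, rfl⟩ := Nat.exists_eq_succ_of_ne_zero hJ
  simp [coeff_zero_eq_eval_zero, eval_expTrunc, hH, Finset.sum_range_succ']

theorem norm_expTrunc_eval_le {H : ℂ[X]} {z : ℂ} {x B : ℝ} (hnorm : ‖H.eval z‖ ≤ B)
    (hJ : 4 * B ≤ J) (hx : -B ≤ x) (hre : (H.eval z).re ≤ x + 1) :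
    ‖(expTrunc J H).eval z‖ ≤ 5 * Real.exp x := by
  have hexp : ‖Complex.exp (H.eval z)‖ ≤ Real.exp 1 * Real.exp x := by
    rw [Complex.norm_exp, ← Real.exp_add]
    exact Real.exp_le_exp.2 (by linarith)
  have htrunc := norm_exp_sub_sum_le_two_mul_exp_neg hnorm hJ
  rw [← eval_expTrunc] at htrunc
  have htri := norm_le_norm_add_norm_sub (Complex.exp (H.eval z)) ((expTrunc J H).eval z)
  have hBx : Real.exp (-B) ≤ Real.exp x := Real.exp_le_exp.2 hx
  nlinarith [Real.exp_one_lt_d9, Real.exp_pos x]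

theorem exists_norm_eval_inv_circlePoint_le_exp (hN : N ≠ 0) (hJ : J ≠ 0)
    (hw : LipschitzWith L w) (hw0 : ∫ t, w t ∂haarAddCircle = 0) (hV : ∀ t, |w t| ≤ V)
    (hL : (L : ℝ) ^ 2 ≤ 4 * N) (hVJ : 4 * (V * N) ≤ J) :
    ∃ Q : ℂ[X], Q.natDegree ≤ J * N ∧ Q.coeff 0 = 1 ∧
      ∀ t, ‖Q.eval (circlePoint t)⁻¹‖ ≤ 5 * Real.exp (w t) := by
  have hV0 : 0 ≤ V := (abs_nonneg _).trans (hV 0)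
  have hN1 : (1 : ℝ) ≤ N := by exact_mod_cast Nat.one_le_iff_ne_zero.2 hN
  refine ⟨expTrunc J (circleConv (analyticFejer N) w), natDegree_expTrunc_le hJ <|
    (natDegree_circleConv_le _ _).trans (natDegree_analyticFejer_le N),
    coeff_zero_expTrunc hJ ?_, fun t => norm_expTrunc_eval_le ?_ hVJ ?_ ?_⟩
  · rw [eval_zero_circleConv, hw0, Complex.ofReal_zero, mul_zero]
  · exact norm_eval_circleConv_le hw.continuous hV
      (fun z hz => norm_eval_analyticFejer_le N hz) t
  · nlinarith [neg_abs_le (w t), hV t]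
  · exact re_eval_circleConv_analyticFejer_le hN hw hL t

theorem szegoMin_expWeight_le (hN : N ≠ 0) (hJ : J ≠ 0) (hu : LipschitzWith L u)
    (hV : ∀ t, |u t| ≤ V) (hL : (L : ℝ) ^ 2 ≤ 4 * N) (hVJ : 4 * (V * N) ≤ J) (hn : J * N ≤ n) :
    szegoMin (expWeight u) n ≤ 5 * Real.exp (-(∫ t, u t ∂haarAddCircle) / 2) := by
  have hu_int : Integrable u haarAddCircle := integrable_of_continuous hu.continuous
  set I := ∫ t, u t ∂haarAddCircle with hI
  have hIV : |I| ≤ V := by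
    simpa only [probReal_univ, mul_one, Real.norm_eq_abs] using
      norm_integral_le_of_norm_le_const (f := u) (μ := haarAddCircle) (C := V) (.of_forall hV)
  have hw : LipschitzWith L fun t => (u t - I) / 2 := .of_dist_le_mul fun s t => by
    have hst := hu.dist_le_mul s t
    rw [Real.dist_eq] at hst ⊢
    rw [← sub_div, sub_sub_sub_cancel_right, abs_div, abs_two]
    linarith [abs_nonneg (u s - u t)]
  have hw0 : ∫ t, (u t - I) / 2 ∂haarAddCircle = 0 := by
    rw [integral_div, integral_sub hu_int (integrable_const I), integral_const, probReal_univ,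
      one_smul, ← hI, sub_self, zero_div]
  have hwV (t : SzegoCircle) : |(u t - I) / 2| ≤ V := by
    rw [abs_div, abs_two]
    linarith [abs_sub (u t) I, hV t]
  obtain ⟨Q, hQdeg, hQ0, hQ⟩ := exists_norm_eval_inv_circlePoint_le_exp hN hJ hw hw0 hwV hL hVJ
  refine (szegoMin_le_of_coeff_zero_eq_one _ (hQdeg.trans hn) hQ0).trans <|
    Real.sqrt_le_iff.2 ⟨by positivity, ?_⟩
  rw [integral_expWeight hu.continuous]
  refine (integral_mono_of_nonneg (.of_forall fun t => by positivity) (integrable_const _)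
    (.of_forall fun t => ?_)).trans_eq (by rw [integral_const, probReal_univ, one_smul])
  calc Real.exp (-u t) * ‖Q.eval (circlePoint t)⁻¹‖ ^ 2
      ≤ Real.exp (-u t) * (5 * Real.exp ((u t - I) / 2)) ^ 2 := by gcongr; exact hQ t
    _ = (5 * Real.exp (-I / 2)) ^ 2 := by
      rw [mul_pow, mul_pow, ← Real.exp_nat_mul, ← Real.exp_nat_mul, mul_left_comm, ← Real.exp_add]
      congr 2
      push_cast
      ring

end ExpWeightUpperBound

section DeepZero

variable {γ a b s : ℝ} {K : Set SzegoCircle} {n : ℕ}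

theorem IsGammaRegularWith.nonempty (ha : 0 < a) (h : IsGammaRegularWith γ a b K) :
    K.Nonempty := by
  rw [nonempty_iff_ne_empty]
  rintro rfl
  have hlow := (h (1 / 2) (by norm_num) le_rfl).1
  rw [nbhdLength, Metric.thickening_empty, measureReal_empty] at hlow
  exact hlow.not_gt (by positivity)

theorem deepZeroMeasure_le_expWeight (hγ1 : γ < 1) (hK : IsClosed K) (hne : K.Nonempty) :
    deepZeroMeasure γ K ≤ expWeight (truncDistPow (1 - γ) s K) := by
  refine withDensity_mono (.of_forall (indicator_le fun t ht => ?_))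
  rw [truncDistPow, neg_sub]
  exact ENNReal.ofReal_le_ofReal <| Real.exp_le_exp.2 <| neg_le_neg <|
    Real.rpow_le_rpow_of_nonpos ((hK.notMem_iff_infDist_pos hne).1 ht) (le_max_left _ _)
      (sub_neg.2 hγ1).le

theorem expWeight_restrict_le_deepZeroMeasure (hs : 0 < s) (hne : K.Nonempty) :
    (expWeight (truncDistPow (1 - γ) s K)).restrict (Metric.thickening s K)ᶜ ≤
      deepZeroMeasure γ K := by
  have hmeas : MeasurableSet (Metric.thickening s K)ᶜ :=
    Metric.isOpen_thickening.measurableSet.compl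
  rw [expWeight, restrict_withDensity hmeas, ← withDensity_indicator hmeas]
  refine withDensity_mono (.of_forall (indicator_le fun t ht => ?_))
  have hst : s ≤ Metric.infDist t K :=
    not_lt.1 fun hlt => ht ((Metric.mem_thickening_iff_infDist_lt hne).2 hlt)
  have htK : t ∈ Kᶜ := fun hmem => (hs.trans_le hst).ne' (Metric.infDist_zero_of_mem hmem)
  rw [indicator_of_mem htK, truncDistPow, max_eq_left hst, neg_sub]

theorem sqrt_exp_neg_integral_le_szegoMin_deepZeroMeasure (hγ1 : γ < 1) (hs : 0 < s)
    (hK : IsClosed K) (hne : K.Nonempty) (hsmall : nbhdLength K s * (n + 1) ≤ 1 / 2) :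
    √(Real.exp (-∫ t, truncDistPow (1 - γ) s K t ∂haarAddCircle) / 2) ≤
      szegoMin (deepZeroMeasure γ K) n := by
  have hv := continuous_truncDistPow (sub_pos.2 hγ1).le hs K
  have := isFiniteMeasure_expWeight hv
  have := isFiniteMeasure_of_le _ (deepZeroMeasure_le_expWeight (s := s) hγ1 hK hne)
  refine (sqrt_exp_neg_integral_le_szegoMin_restrict_compl (M := s ^ (-(1 - γ))) hv
    Metric.isOpen_thickening.measurableSet hsmall (fun t ht => ?_)
    fun t _ => truncDistPow_le (sub_pos.2 hγ1).le hs t).trans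
    (szegoMin_mono (expWeight_restrict_le_deepZeroMeasure hs hne) n)
  rw [truncDistPow, max_eq_right ((Metric.mem_thickening_iff_infDist_lt hne).1 ht).le]

theorem exists_scale_of_two_le (hγ1 : γ < 1) (hb : 0 < b) :
    ∃ D : ℝ, 0 ≤ D ∧ ∀ n : ℕ, 2 ≤ n → ∃ s : ℝ, 0 < s ∧ s ≤ 1 / 2 ∧
      b * s ^ (1 - γ) * (n + 1) ≤ 1 / 2 ∧ (1 - γ) * Real.log (1 / 2 / s) = Real.log n + D := by
  have hκ : 0 < 1 - γ := sub_pos.2 hγ1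
  set η : ℝ := min (1 / (4 * b)) ((1 / 2) ^ (1 - γ))
  have hη : 0 < η := by positivity
  have hbη : b * η ≤ 1 / 4 := calc
    b * η ≤ b * (1 / (4 * b)) := by gcongr; exact min_le_left _ _
    _ = 1 / 4 := by field_simp
  refine ⟨Real.log ((1 / 2) ^ (1 - γ) / η),
    Real.log_nonneg ((one_le_div hη).2 (min_le_right _ _)), fun n hn => ?_⟩
  have hn2 : (2 : ℝ) ≤ n := by exact_mod_cast hn
  have hn0 : (0 : ℝ) < n := by linarith
  have hs : 0 < (η / n) ^ (1 - γ)⁻¹ := by positivity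
  have hsκ : ((η / n) ^ (1 - γ)⁻¹) ^ (1 - γ) = η / n := Real.rpow_inv_rpow (by positivity) hκ.ne'
  refine ⟨_, hs, ?_, ?_, ?_⟩
  · rw [← Real.rpow_le_rpow_iff hs.le (by norm_num) hκ, hsκ]
    exact (div_le_self hη.le (by linarith)).trans (min_le_right _ _)
  · rw [hsκ, ← mul_div_assoc, div_mul_eq_mul_div, div_le_iff₀ hn0]
    nlinarith
  · rw [← Real.log_rpow (by positivity), Real.div_rpow (by norm_num) hs.le, hsκ, div_div_eq_mul_div,
      mul_div_right_comm, Real.log_mul (by positivity) hn0.ne', add_comm]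

theorem exists_exp_neg_mul_log_le_szegoMin (hγ1 : γ < 1) (hb : 0 < b) :
    ∃ C : ℝ, 0 < C ∧ ∀ K : Set SzegoCircle, IsClosed K → K.Nonempty →
      (∀ r, 0 < r → r ≤ 1 / 2 → nbhdLength K r ≤ b * r ^ (1 - γ)) → ∀ n : ℕ, 2 ≤ n →
        Real.exp (-(C * Real.log n)) ≤ szegoMin (deepZeroMeasure γ K) n := by
  have hlog2 : 0 < Real.log 2 := Real.log_pos one_lt_two
  obtain ⟨D, hD, hscale⟩ := exists_scale_of_two_le hγ1 hb
  set B : ℝ := (1 / 2) ^ (-(1 - γ)) + b * D + Real.log 2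
  have hB : 0 < B := by positivity
  refine ⟨(b + B / Real.log 2) / 2, half_pos (add_pos hb (div_pos hB hlog2)),
    fun K hK hne hreg n hn => ?_⟩
  obtain ⟨s, hs, hs2, hsmall, hlog⟩ := hscale n hn
  have h_int := integral_truncDistPow_le (sub_pos.2 hγ1) hs hs2 hne hreg
  rw [hlog] at h_int
  refine le_trans (Real.le_sqrt_of_sq_le ?_)
    (sqrt_exp_neg_integral_le_szegoMin_deepZeroMeasure hγ1 hs hK hne
      ((mul_le_mul_of_nonneg_right (hreg s hs hs2) (by positivity)).trans hsmall))
  have hBlog : B ≤ B / Real.log 2 * Real.log n := by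
    rw [div_mul_eq_mul_div, le_div_iff₀ hlog2]
    gcongr
    exact_mod_cast hn
  calc Real.exp (-((b + B / Real.log 2) / 2 * Real.log n)) ^ 2
      = Real.exp (-(b * Real.log n + B / Real.log 2 * Real.log n)) := by
        rw [← Real.exp_nat_mul]
        congr 1
        push_cast
        ring
    _ ≤ Real.exp (-(∫ t, truncDistPow (1 - γ) s K t ∂haarAddCircle) - Real.log 2) :=
        Real.exp_le_exp.2 (by linarith)
    _ = Real.exp (-∫ t, truncDistPow (1 - γ) s K t ∂haarAddCircle) / 2 := by
        rw [Real.exp_sub, Real.exp_log two_pos]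

theorem szegoMin_expWeight_le_exp_neg_half {v : SzegoCircle → ℝ} {M : ℝ} (hv : Continuous v)
    (hM : ∀ t, M ≤ v t) (n : ℕ) : szegoMin (expWeight v) n ≤ Real.exp (-M / 2) := by
  refine (szegoMin_le_of_coeff_zero_eq_one _ (natDegree_one.trans_le n.zero_le)
    coeff_one_zero).trans (Real.sqrt_le_iff.2 ⟨(Real.exp_pos _).le, ?_⟩)
  simp only [eval_one, norm_one, one_pow]
  rw [integral_expWeight hv, ← Real.exp_nat_mul]
  refine (integral_mono_of_nonneg (.of_forall fun t => by positivity)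
    (integrable_const (Real.exp (-M))) (.of_forall fun t => ?_)).trans_eq ?_
  · simpa only [mul_one, Real.exp_le_exp, neg_le_neg_iff] using hM t
  · rw [integral_const, probReal_univ, one_smul]
    congr 1
    push_cast
    ring

theorem one_le_truncDistPow_half (hγ1 : γ < 1) (hne : K.Nonempty) (t : SzegoCircle) :
    1 ≤ truncDistPow (1 - γ) (1 / 2) K t := by
  obtain ⟨x, hx⟩ := hne
  have hdist : Metric.infDist t K ≤ 1 / 2 :=
    (Metric.infDist_le_dist_of_mem hx).trans ((dist_eq_norm t x).trans_le (norm_le_half _))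
  rw [truncDistPow, max_eq_right hdist]
  exact Real.one_le_rpow_of_pos_of_le_one_of_nonpos (by norm_num) (by norm_num)
    (neg_nonpos.2 (sub_pos.2 hγ1).le)

theorem szegoMin_deepZeroMeasure_le_expWeight (hγ1 : γ < 1) (hs : 0 < s) (hK : IsClosed K)
    (hne : K.Nonempty) (n : ℕ) : szegoMin (deepZeroMeasure γ K) n ≤
      szegoMin (expWeight (truncDistPow (1 - γ) s K)) n :=
  have := isFiniteMeasure_expWeight (continuous_truncDistPow (sub_pos.2 hγ1).le hs K)
  szegoMin_mono (deepZeroMeasure_le_expWeight hγ1 hK hne) n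

theorem szegoMin_deepZeroMeasure_le_exp_neg_half (hγ1 : γ < 1) (hK : IsClosed K)
    (hne : K.Nonempty) (n : ℕ) : szegoMin (deepZeroMeasure γ K) n ≤ Real.exp (-1 / 2) :=
  (szegoMin_deepZeroMeasure_le_expWeight hγ1 one_half_pos hK hne n).trans
    (szegoMin_expWeight_le_exp_neg_half (continuous_truncDistPow (sub_pos.2 hγ1).le one_half_pos K)
      (one_le_truncDistPow_half hγ1 hne) n)

theorem szegoMin_deepZeroMeasure_le_of_inv_nat (hγ0 : 0 ≤ γ) (hγ1 : γ < 1) (hK : IsClosed K)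
    (hne : K.Nonempty) {M : ℕ} (hM : M ≠ 0) (hn : 4 * M ^ 9 ≤ n) :
    szegoMin (deepZeroMeasure γ K) n ≤
      5 * Real.exp (-(∫ t, truncDistPow (1 - γ) (M : ℝ)⁻¹ K t ∂haarAddCircle) / 2) := by
  have hκ : 0 < 1 - γ := sub_pos.2 hγ1
  have hM0 : (0 : ℝ) < M := by positivity
  have hM1 : (1 : ℝ) ≤ M := by exact_mod_cast Nat.one_le_iff_ne_zero.2 hM
  have hs : 0 < (M : ℝ)⁻¹ := inv_pos.2 hM0
  have hbound (t : SzegoCircle) : |truncDistPow (1 - γ) (M : ℝ)⁻¹ K t| ≤ M := by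
    rw [abs_of_nonneg (truncDistPow_nonneg t)]
    refine (truncDistPow_le hκ.le hs t).trans ?_
    rw [Real.inv_rpow hM0.le, Real.rpow_neg hM0.le, inv_inv]
    exact Real.rpow_le_self_of_one_le hM1 (by linarith)
  have hlip : (1 - γ) * (M : ℝ)⁻¹ ^ (-(1 - γ) - 1) ≤ (M : ℝ) ^ 2 := by
    rw [Real.inv_rpow hM0.le, ← Real.rpow_neg hM0.le, ← Real.rpow_two]
    exact (mul_le_of_le_one_left (by positivity) (by linarith)).trans
      (Real.rpow_le_rpow_of_exponent_le hM1 (by linarith))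
  refine (szegoMin_deepZeroMeasure_le_expWeight hγ1 hs hK hne n).trans
    (szegoMin_expWeight_le (N := M ^ 4) (J := 4 * M ^ 5) (V := M) (by positivity) (by positivity)
      (lipschitzWith_truncDistPow hκ.le hs K) hbound ?_ ?_ ?_)
  · rw [Real.coe_toNNReal _ (by positivity)]
    calc ((1 - γ) * (M : ℝ)⁻¹ ^ (-(1 - γ) - 1)) ^ 2 ≤ ((M : ℝ) ^ 2) ^ 2 := by gcongr
      _ = (M : ℝ) ^ 4 := by ring
      _ ≤ 4 * ((M ^ 4 : ℕ) : ℝ) := by push_cast; linarith [pow_pos hM0 4]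
  · push_cast; exact (by ring : 4 * ((M : ℝ) * M ^ 4) = 4 * M ^ 5).le
  · exact (by ring : 4 * M ^ 5 * M ^ 4 = 4 * M ^ 9).trans_le hn

theorem exists_mul_pow_le_and_lt_mul_succ_pow {k c : ℕ} (hk : k ≠ 0) (hc : c ≠ 0) (n : ℕ) :
    ∃ m : ℕ, c * m ^ k ≤ n ∧ n < c * (m + 1) ^ k := by
  have hle := Nat.pow_nthRoot_le (a := n / c) (.inl hk)
  have hlt := Nat.lt_pow_nthRoot_add_one hk (n / c)
  rw [Nat.le_div_iff_mul_le (Nat.pos_of_ne_zero hc), mul_comm] at hle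
  rw [Nat.div_lt_iff_lt_mul (Nat.pos_of_ne_zero hc), mul_comm] at hlt
  exact ⟨_, hle, hlt⟩

theorem szegoMin_deepZeroMeasure_le_five_mul_exp (hγ0 : 0 ≤ γ) (hγ1 : γ < 1) (ha : 0 < a)
    (hK : IsClosed K) (hne : K.Nonempty)
    (hreg : ∀ r, 0 < r → r ≤ 1 / 2 → a * r ^ (1 - γ) ≤ nbhdLength K r) (hn : n ≠ 0) :
    szegoMin (deepZeroMeasure γ K) n ≤
      5 * Real.exp (-(a * (1 - γ) / 18 * (Real.log n - 20 * Real.log 2))) := by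
  have hκ : 0 < 1 - γ := sub_pos.2 hγ1
  obtain ⟨m, hmn, hnm⟩ :=
    exists_mul_pow_le_and_lt_mul_succ_pow (by norm_num : 9 ≠ 0) (by norm_num : 2 ^ 11 ≠ 0) n
  rcases Nat.eq_zero_or_pos m with rfl | hm
  · have hlog : Real.log n ≤ 20 * Real.log 2 := by
      rw [← Nat.cast_ofNat (n := 20), ← Real.log_pow]
      gcongr
      exact_mod_cast hnm.le.trans (by norm_num)
    have hexp : 1 ≤ Real.exp (-(a * (1 - γ) / 18 * (Real.log n - 20 * Real.log 2))) :=
      Real.one_le_exp (neg_nonneg.2 (mul_nonpos_of_nonneg_of_nonpos (by positivity)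
        (sub_nonpos.2 hlog)))
    have hhalf : Real.exp (-1 / 2) ≤ 1 := Real.exp_le_one_iff.2 (by norm_num)
    linarith [szegoMin_deepZeroMeasure_le_exp_neg_half hγ1 hK hne n]
  · have hm1 : (1 : ℝ) ≤ m := by exact_mod_cast hm
    refine (szegoMin_deepZeroMeasure_le_of_inv_nat hγ0 hγ1 hK hne (M := 2 * m) (by positivity)
      ((by ring : 4 * (2 * m) ^ 9 = 2 ^ 11 * m ^ 9).trans_le hmn)).trans ?_
    have hs : ((2 * m : ℕ) : ℝ)⁻¹ ≤ 1 / 2 := by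
      push_cast
      rw [one_div]
      exact inv_anti₀ two_pos (by linarith)
    have hdiv : 1 / 2 / ((2 * m : ℕ) : ℝ)⁻¹ = m := by
      push_cast
      rw [div_inv_eq_mul, one_div, inv_mul_cancel_left₀ two_ne_zero]
    have h_int := le_integral_truncDistPow hκ (by positivity) hs hne hreg
    rw [hdiv] at h_int
    have hlog : Real.log n ≤ 20 * Real.log 2 + 9 * Real.log m := by
      have hpow : (n : ℝ) ≤ 2 ^ 20 * m ^ 9 := by
        exact_mod_cast hnm.le.trans ((Nat.mul_le_mul_left _
          (Nat.pow_le_pow_left (by omega : m + 1 ≤ 2 * m) 9)).trans_eq (by ring))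
      have := Real.log_le_log (by positivity) hpow
      rwa [Real.log_mul (by positivity) (by positivity), Real.log_pow, Real.log_pow] at this
    gcongr
    have := mul_le_mul_of_nonneg_left hlog (by positivity : 0 ≤ a * (1 - γ) / 18)
    linarith

theorem exists_szegoMin_le_exp_neg_mul_log (hγ0 : 0 ≤ γ) (hγ1 : γ < 1) (ha : 0 < a) :
    ∃ c : ℝ, 0 < c ∧ ∀ K : Set SzegoCircle, IsClosed K → K.Nonempty →
      (∀ r, 0 < r → r ≤ 1 / 2 → a * r ^ (1 - γ) ≤ nbhdLength K r) → ∀ n : ℕ, 2 ≤ n →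
        szegoMin (deepZeroMeasure γ K) n ≤ Real.exp (-(c * Real.log n)) := by
  set A : ℝ := a * (1 - γ) / 18
  set B : ℝ := A * (20 * Real.log 2) + Real.log 5
  have hA : 0 < A := div_pos (mul_pos ha (sub_pos.2 hγ1)) (by norm_num)
  have hB : 0 < B := add_pos (mul_pos hA (by positivity)) (Real.log_pos (by norm_num))
  refine ⟨A / (1 + 2 * B), by positivity, fun K hK hne hreg n hn => ?_⟩
  have hweak := szegoMin_deepZeroMeasure_le_exp_neg_half hγ1 hK hne n
  have hstrong : szegoMin (deepZeroMeasure γ K) n ≤ Real.exp (-(A * Real.log n - B)) := by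
    refine (szegoMin_deepZeroMeasure_le_five_mul_exp hγ0 hγ1 ha hK hne hreg
      (by omega)).trans_eq ?_
    nth_rw 1 [← Real.exp_log (by norm_num : (0 : ℝ) < 5)]
    rw [← Real.exp_add]
    congr 1
    ring
  -- The two exponents `1 / 2` and `A log n - B` average to `A log n / (1 + 2 * B)`
  -- with weights `2 * B` and `1`, so the larger one is at least that.
  rw [div_mul_eq_mul_div]
  rcases le_total (A * Real.log n) ((1 + 2 * B) * (1 / 2)) with h | h
  · refine hweak.trans (Real.exp_le_exp.2 ?_)
    linarith [(div_le_iff₀' (by positivity)).2 h]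
  · refine hstrong.trans (Real.exp_le_exp.2 (neg_le_neg ?_))
    rw [div_le_iff₀ (by positivity)]
    nlinarith

end DeepZero

theorem mainTheorem7 (γ : ℝ) (hγ0 : 0 ≤ γ) (hγ1 : γ < 1)
    (a b : ℝ) (ha : 0 < a) (hb : 0 < b) :
    ∃ c C : ℝ, 0 < c ∧ 0 < C ∧
      ∀ K : Set SzegoCircle, IsCompact K → IsGammaRegularWith γ a b K →
        ∀ n : ℕ, 2 ≤ n →
          c * Real.log n ≤ |Real.log (szegoMin (deepZeroMeasure γ K) n)| ∧
          |Real.log (szegoMin (deepZeroMeasure γ K) n)| ≤ C * Real.log n := by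
  obtain ⟨c, hc, hupper⟩ := exists_szegoMin_le_exp_neg_mul_log hγ0 hγ1 ha
  obtain ⟨C, hC, hlower⟩ := exists_exp_neg_mul_log_le_szegoMin hγ1 hb
  refine ⟨c, C, hc, hC, fun K hK hreg n hn => ?_⟩
  have hne := hreg.nonempty ha
  have hle := hupper K hK.isClosed hne (fun r hr hr2 => (hreg r hr hr2).1) n hn
  have hge := hlower K hK.isClosed hne (fun r hr hr2 => (hreg r hr hr2).2) n hn
  have hpos : 0 < szegoMin (deepZeroMeasure γ K) n := (Real.exp_pos _).trans_le hge
  have hlogn : 0 ≤ c * Real.log n := mul_nonneg hc.le (Real.log_natCast_nonneg n)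
  have hlog_le := (Real.log_le_iff_le_exp hpos).2 hle
  have hlog_ge := (Real.le_log_iff_exp_le hpos).2 hge
  rw [abs_of_nonpos (by linarith)]
  exact ⟨by linarith, by linarith⟩
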